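/- Let $k$ be a commutative artinian ring and let $\Lambda$ be an artin $k$-algebra, i.e. a $k$-algebra that is finitely generated as a $k$-module. Let $\Lambda\text{-}\mathrm{mod}$ be the category of finitely generated left $\Lambda$-modules, let $A$ be an object of $\Lambda\text{-}\mathrm{mod}$, and let $F : \Lambda\text{-}\mathrm{mod} \to \mathrm{Ab}$ be an additive functor. If $F$ is a direct summand of the covariant functor $\mathrm{Ext}^1(A,-) : \Lambda\text{-}\mathrm{mod} \to \mathrm{Ab}$ (that is, there are natural transformations $\iota : F \to \mathrm{Ext}^1(A,-)$ and $\pi : \mathrm{Ext}^1(A,-) \to F$ with $\pi\iota = 1_F$), then there exists a submodule $B$ of $A$ such that $F \simeq \mathrm{Ext}^1(B,-)$ as functors $\Lambda\text{-}\mathrm{mod} \to \mathrm{Ab}$. -/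

import Mathlib

open CategoryTheory CategoryTheory.Abelian

universe u w

/-- An artin algebra: an algebra `Λ` over a commutative artinian ring `k` which is finitely
generated as a `k`-module. -/
class IsArtinAlgebra (k : Type w) (Λ : Type u) [CommRing k] [Ring Λ] [Algebra k Λ] : Prop where
  isArtinianRing : IsArtinianRing k
  finite : Module.Finite k Λ

/-- An artin algebra is a (left) noetherian ring, so that its finitely generated modules form an
abelian category. -/
theorem IsArtinAlgebra.isNoetherianRing (k : Type w) (Λ : Type u) [CommRing k] [Ring Λ]
    [Algebra k Λ] [h : IsArtinAlgebra k Λ] : IsNoetherianRing Λ := by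
  have := h.isArtinianRing
  have := h.finite
  exact isNoetherian_of_tower k (inferInstance : IsNoetherian k Λ)

section

variable (Λ : Type u) [Ring Λ] [IsNoetherianRing Λ]

/-- Finite free modules are projective objects in the category of finitely generated modules. -/
theorem fgModuleCat_projective_free (n : ℕ) :
    Projective (FGModuleCat.of Λ (Fin n → Λ)) where
  factors {E Y} g e he := by
    have h1 : Epi ((forget₂ (FGModuleCat Λ) (ModuleCat Λ)).map e) := inferInstance
    have h2 : Function.Surjective e.hom.hom := (ModuleCat.epi_iff_surjective _).1 h1
    obtain ⟨l, hl⟩ := Module.projective_lifting_property e.hom.hom g.hom.hom h2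
    exact ⟨FGModuleCat.ofHom l, FGModuleCat.hom_ext hl⟩

/-- The category of finitely generated modules over a noetherian ring has enough projectives. -/
instance fgModuleCat_enoughProjectives : EnoughProjectives (FGModuleCat.{u} Λ) where
  presentation X := by
    obtain ⟨n, f, hf⟩ := Module.Finite.exists_fin' Λ X
    have hp := fgModuleCat_projective_free Λ n
    let g : FGModuleCat.of Λ (Fin n → Λ) ⟶ X := FGModuleCat.ofHom f
    have hg : Epi g := by
      apply (forget₂ (FGModuleCat Λ) (ModuleCat Λ)).epi_of_epi_map
      exact (ModuleCat.epi_iff_surjective _).2 hf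
    exact ⟨{ p := FGModuleCat.of Λ (Fin n → Λ), f := g }⟩

/-- The `Ext` groups of finitely generated `Λ`-modules live in the universe of `Λ`. -/
instance fgModuleCat_hasExt : HasExt.{u} (FGModuleCat.{u} Λ) :=
  hasExt_of_enoughProjectives.{u} (FGModuleCat.{u} Λ)

end

/-! The idempotent of `Ext¹(A, -)` cutting out `F` is induced by some `f : A ⟶ A`, and so by every
positive power of `f`. By Fitting's lemma one such power is an automorphism `g` of a direct summand
`B`, extended by zero. Then `g` induces an invertible idempotent on `Ext¹(B, -)`, hence the
identity, so the idempotent splits through `Ext¹(B, -)`. -/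

namespace CategoryTheory.Abelian

open Limits

/-- With enough projectives, every natural transformation between the functors `Ext¹(X, -)` and
`Ext¹(Y, -)` is induced by a morphism `Y ⟶ X`. -/
theorem extFunctor_one_map_surjective {C : Type*} [Category C] [Abelian C] [HasExt.{w} C]
    [EnoughProjectives C] {X Y : C} (φ : extFunctorObj.{w} X 1 ⟶ extFunctorObj Y 1) :
    ∃ f : Y ⟶ X, (extFunctor.{w} (C := C) 1).map f.op = φ := by
  let S : ShortComplex C :=
    ShortComplex.mk (kernel.ι (Projective.π X)) (Projective.π X) (kernel.condition _)
  have hS : S.ShortExact := { exact := ShortComplex.exact_kernel _ }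
  have hφ {U V : C} (x : Ext X U 1) (u : U ⟶ V) :
      φ.app V (x.comp (Ext.mk₀ u) (add_zero 1)) =
        Ext.comp (φ.app U x : Ext Y U 1) (Ext.mk₀ u) (add_zero 1) :=
    DFunLike.congr_fun (congrArg AddCommGrpCat.Hom.hom (φ.naturality u)) x
  -- The class of `S` pushes forward to zero in the projective cover term `S.X₂`, so its image under
  -- `φ` does too and comes from a map `Y ⟶ X`.
  have h₀ : Ext.comp (φ.app S.X₁ hS.extClass : Ext Y S.X₁ 1) (Ext.mk₀ S.f) (add_zero 1) = 0 := by
    rw [← hφ, hS.extClass_comp]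
    exact map_zero (φ.app S.X₂).hom
  obtain ⟨x, hx⟩ := Ext.covariant_sequence_exact₁ Y hS _ h₀ (zero_add 1)
  obtain ⟨f, rfl⟩ := (Ext.mk₀_bijective Y X).2 x
  refine ⟨f, ?_⟩
  ext Z y
  -- As `S.X₂` is projective, every class in `Ext¹(X, Z)` is a pushout of the class of `S`, which
  -- therefore determines `φ`.
  obtain ⟨z, rfl⟩ := Ext.contravariant_sequence_exact₃ hS Z y
    (Ext.eq_zero_of_projective (P := Projective.over X) (n := 0) _) (add_zero 1)
  obtain ⟨u, rfl⟩ := (Ext.mk₀_bijective S.X₁ Z).2 z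
  refine Eq.trans ?_ (hφ hS.extClass u).symm
  rw [← hx]
  exact (Ext.comp_assoc_of_third_deg_zero _ _ _ _).symm

/-- If an idempotent `π ≫ ι` splits through `F` and also equals a composite `a ≫ b` with
`b ≫ a = 𝟙`, then the two splittings are isomorphic. -/
def _root_.CategoryTheory.Retract.isoOfFactorization {C : Type*} [Category C] {F G H : C}
    (r : Retract F G) (a : G ⟶ H) (b : H ⟶ G) (hba : b ≫ a = 𝟙 H) (hab : a ≫ b = r.r ≫ r.i) :
    F ≅ H where
  hom := r.i ≫ a
  inv := b ≫ r.r
  hom_inv_id := by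
    rw [Category.assoc, reassoc_of% hab]
    simp
  inv_hom_id := by
    rw [Category.assoc, ← reassoc_of% hab, hba, Category.comp_id, hba]

end CategoryTheory.Abelian

/-- Fitting's lemma, as a factorization: some positive power of an endomorphism of a module of
finite length factors as a projection onto a direct summand, an automorphism of this summand,
and its inclusion. -/
theorem Module.End.exists_pow_eq_subtype_comp {R M : Type*} [Ring R] [AddCommGroup M] [Module R M]
    [IsArtinian R M] [IsNoetherian R M] (f : Module.End R M) :
    ∃ (n : ℕ) (B : Submodule R M) (p : M →ₗ[R] B) (g : B ≃ₗ[R] B),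
      p ∘ₗ B.subtype = LinearMap.id ∧ f ^ (n + 1) = B.subtype ∘ₗ g.toLinearMap ∘ₗ p := by
  obtain ⟨N, hN⟩ := Filter.eventually_atTop.1 f.eventually_isCompl_ker_pow_range_pow
  -- The exponent must be positive: the zeroth power would induce the identity, not the idempotent.
  have hc := hN (N + 1) N.le_succ
  set h := f ^ (N + 1)
  let p := (LinearMap.range h).projectionOnto (LinearMap.ker h) hc.symm
  let g : LinearMap.range h →ₗ[R] LinearMap.range h := h.rangeRestrict ∘ₗ Submodule.subtype _
  have hg : Function.Injective g := by
    rw [← LinearMap.ker_eq_bot, LinearMap.ker_eq_bot']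
    intro b hb
    exact Subtype.ext (Submodule.disjoint_def.1 hc.disjoint b (congrArg Subtype.val hb) b.2)
  have hp : p ∘ₗ Submodule.subtype _ = LinearMap.id := by
    ext b
    simp [p]
  refine ⟨N, _, p, LinearEquiv.ofBijective g
    ⟨hg, IsArtinian.surjective_of_injective_endomorphism g hg⟩, hp, ?_⟩
  ext m
  have hm : m - (p m : M) ∈ LinearMap.ker h := by
    rw [← Submodule.ker_projectionOnto hc.symm, LinearMap.mem_ker, map_sub, sub_eq_zero]
    exact (LinearMap.congr_fun hp (p m)).symm
  rw [LinearMap.mem_ker, map_sub, sub_eq_zero] at hm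
  exact hm

theorem corollary4p4 (k : Type w) (Λ : Type u) [CommRing k] [Ring Λ] [Algebra k Λ]
    [IsArtinAlgebra k Λ] (A : FGModuleCat.{u} Λ)
    (F : FGModuleCat.{u} Λ ⥤ AddCommGrpCat.{u}) [F.Additive] :
    haveI : IsNoetherianRing Λ := IsArtinAlgebra.isNoetherianRing k Λ
    Nonempty (Retract F (extFunctorObj A 1)) →
      ∃ B : Submodule Λ A, Nonempty (F ≅ extFunctorObj (FGModuleCat.of Λ B) 1) := by
  have : IsNoetherianRing Λ := IsArtinAlgebra.isNoetherianRing k Λ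
  have : IsArtinianRing k := IsArtinAlgebra.isArtinianRing Λ
  have : Module.Finite k Λ := IsArtinAlgebra.finite
  have : IsArtinianRing Λ := IsArtinianRing.of_finite k Λ
  let E := extFunctor.{u} (C := FGModuleCat.{u} Λ) 1
  rintro ⟨r : Retract F (E.obj (Opposite.op A))⟩
  obtain ⟨f, hf : E.map f.op = r.r ≫ r.i⟩ := extFunctor_one_map_surjective (r.r ≫ r.i)
  obtain ⟨n, B, p, g, hp, hn⟩ := Module.End.exists_pow_eq_subtype_comp f.hom.hom
  have hpow (m : ℕ) : E.map (FGModuleCat.ofHom (f.hom.hom ^ (m + 1))).op = r.r ≫ r.i := by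
    induction m with
    | zero => rw [zero_add, pow_one]; exact hf
    | succ m ih =>
      have h : FGModuleCat.ofHom (f.hom.hom ^ (m + 1 + 1)) =
          f ≫ FGModuleCat.ofHom (f.hom.hom ^ (m + 1)) := by
        rw [pow_succ]
        rfl
      rw [h, op_comp, E.map_comp, ih, hf]
      simp
  let i' : FGModuleCat.of Λ B ⟶ A := FGModuleCat.ofHom B.subtype
  let p' : A ⟶ FGModuleCat.of Λ B := FGModuleCat.ofHom p
  let g' : FGModuleCat.of Λ B ≅ FGModuleCat.of Λ B := g.toFGModuleCatIso
  have hip : i' ≫ p' = 𝟙 _ := FGModuleCat.hom_ext hp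
  have hpi : E.map p'.op ≫ E.map i'.op = 𝟙 _ := by
    rw [← E.map_comp, ← op_comp, hip, op_id, E.map_id]
  have hfac : E.map i'.op ≫ E.map g'.hom.op ≫ E.map p'.op = r.r ≫ r.i := by
    rw [← hpow n, ← E.map_comp, ← E.map_comp, ← op_comp, ← op_comp, hn]
    rfl
  -- Sandwiching the idempotent between `E.map p'.op` and `E.map i'.op` makes `E.map g'.hom.op`
  -- idempotent; being invertible, it can be cancelled.
  have hg : E.map g'.hom.op = 𝟙 _ := by
    have hidem : (r.r ≫ r.i) ≫ r.r ≫ r.i = r.r ≫ r.i := by simp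
    rw [← hfac] at hidem
    have h := congrArg (fun t ↦ E.map p'.op ≫ t ≫ E.map i'.op) hidem
    simp only [Category.assoc, hpi, reassoc_of% hpi, Category.comp_id] at h
    rwa [← cancel_epi (E.map g'.hom.op), Category.comp_id]
  rw [hg, Category.id_comp] at hfac
  exact ⟨B, ⟨r.isoOfFactorization (E.map i'.op) (E.map p'.op) hpi hfac⟩⟩
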